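/- **Setting.** Let $(A,\Omega,u)$ be an abstract state space: $A$ is a finite-dimensional real vector space, $\Omega\subset A$ is convex and compact, $A_+:=\mathbb R_{\ge 0}\cdot\Omega$ is a closed generating cone (non-empty, closed under sums and non-negative multiples, $A_+\cap(-A_+)=\{0\}$), and $u\in A^*$ satisfies $u(x)>0$ for $0\ne x\in A_+$ and, for $x\in A_+$, $u(x)=1\Leftrightarrow x\in\Omega$. Elements of $\Omega$ are states, extreme points of $\Omega$ are pure states, and effects are the $e\in A^*$ with $0\le e\le u$ on $A_+$. A transformation is a linear map $T:A\to A$ with $T(A_+)\subset A_+$ and $u\circ T\le u$ on $A_+$; an operation is a finite family of transformations $T_j$ with $\sum_j u\circ T_j=u$. Let there also be given a set of allowed effects, which is convex, closed, spans $A^*$, contains $u-e$ with every $e$, and contains $e+f$ for allowed $e,f$ with $e+f\le u$ on $A_+$; and a group $\mathcal G$ of invertible linear maps which, with their inverses, are transformations and under which $e\mapsto e\circ T$ preserves allowed effects (the allowed reversible transformations). States $w_1,\dots,w_n$ are perfectly distinguishable if there are allowed effects $e_1,\dots,e_n$ with $\sum_j e_j\le u$ on $A_+$ and $e_j(w_k)=\delta_{jk}$.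 A frame is a finite family of perfectly distinguishable pure states; it is maximal if it cannot be enlarged to a bigger frame. A classical decomposition of $w$ is $w=\sum_j p_jw_j$ with $(p_j)$ a probability distribution and $(w_j)$ a frame. The entropy of a state is $S(w)=-\sum_j p_j\ln p_j$ for any classical decomposition ($0\ln 0=0$). **Theorem.** Assume * (Postulate 1, classical decomposability) every state has a classical decomposition; * (Postulate 2, strong symmetry) for any two frames $w_1,\dots,w_n$ and $v_1,\dots,v_n$ of the same size there is $T\in\mathcal G$ with $Tw_j=v_j$ for all $j$. Let $P_1,\dots,P_n$ be linear projectors ($P_j^2=P_j$) which form an operation (in particular they are positive), such that the range of $P_j$ is the line $\mathbb R w_j'$, where $w_1',\dots,w_n'$ is a maximal frame. Let $w\in\Omega$ be any state and $w':=\sum_j P_jw$ the state of the ensemble after the measurement. Then: 1. for every maximal frame $v_1,\dots,v_m$ one has $m=n$, and the transition matrix $M_{jk}=u(P_jv_k)$ is doubly stochastic (non-negative entries, all row and column sums equal to $1$); 2. $w'\in\Omega$, and the entropies of $w$ and $w'$ are well-defined (each of the two states has a classical decomposition, and all its classical decompositions give the same value); 3. $S(w')\ge S(w)$. -/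

import Mathlib

/-- A cone in a real vector space: a non-empty set, closed under addition and under multiplication
by non-negative reals, that meets its negative only in `0`. -/
structure IsPointedCone {A : Type*} [AddCommGroup A] [Module ℝ A] (K : Set A) : Prop where
  nonempty : K.Nonempty
  add_mem : ∀ x ∈ K, ∀ y ∈ K, x + y ∈ K
  smul_mem : ∀ r : ℝ, 0 ≤ r → ∀ x ∈ K, r • x ∈ K
  pointed : ∀ x, x ∈ K → -x ∈ K → x = 0

/-- The set `ℝ≥0 · Ω` of all non-negative multiples of elements of `Ω`. -/
def nonnegMultiples {A : Type*} [AddCommGroup A] [Module ℝ A] (Ω : Set A) : Set A :=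
  {x | ∃ r : ℝ, 0 ≤ r ∧ ∃ w ∈ Ω, x = r • w}

/-- An abstract state space `(A, Ω, u)` on a finite-dimensional real vector space `A`.
The norm of `A` only serves to provide the (unique) vector space topology. -/
structure AbstractStateSpace (A : Type*) [NormedAddCommGroup A] [NormedSpace ℝ A]
    [FiniteDimensional ℝ A] where
  /-- the set `Ω` of normalized states -/
  states : Set A
  /-- the order unit `u` -/
  orderUnit : Module.Dual ℝ A
  convex_states : Convex ℝ states
  isCompact_states : IsCompact states
  isPointedCone : IsPointedCone (nonnegMultiples states)
  isClosed_cone : IsClosed (nonnegMultiples states)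
  generating : Submodule.span ℝ (nonnegMultiples states) = ⊤
  orderUnit_pos : ∀ x ∈ nonnegMultiples states, x ≠ 0 → 0 < orderUnit x
  orderUnit_eq_one_iff : ∀ x ∈ nonnegMultiples states, orderUnit x = 1 ↔ x ∈ states

namespace AbstractStateSpace

variable {A : Type*} [NormedAddCommGroup A] [NormedSpace ℝ A] [FiniteDimensional ℝ A]

/-- The cone `A₊ = ℝ≥0 · Ω` of unnormalized states. -/
def cone (S : AbstractStateSpace A) : Set A := nonnegMultiples S.states

/-- The pure states: the extreme points of `Ω`. -/
def pureStates (S : AbstractStateSpace A) : Set A := Set.extremePoints ℝ S.states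

/-- The mathematically well-defined effects: linear functionals with `0 ≤ e ≤ u` on the cone. -/
def effects (S : AbstractStateSpace A) : Set (Module.Dual ℝ A) :=
  {e | ∀ x ∈ S.cone, 0 ≤ e x ∧ e x ≤ S.orderUnit x}

/-- A transformation of the state space into itself: a linear map that is positive and does not
increase the normalization. -/
structure IsTransformation (S : AbstractStateSpace A) (T : A →ₗ[ℝ] A) : Prop where
  positive : ∀ x ∈ S.cone, T x ∈ S.cone
  orderUnit_le : ∀ x ∈ S.cone, S.orderUnit (T x) ≤ S.orderUnit x

/-- An operation: finitely many transformations `T j` with `∑ j, u ∘ T j = u`. -/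
structure IsOperation (S : AbstractStateSpace A) {n : ℕ} (T : Fin n → (A →ₗ[ℝ] A)) : Prop where
  isTransformation : ∀ j, S.IsTransformation (T j)
  sum_eq : ∑ j, S.orderUnit ∘ₗ T j = S.orderUnit

end AbstractStateSpace

/-- A dynamical state space: an abstract state space together with the set of physically allowed
effects and the group of physically allowed reversible transformations. -/
structure DynamicalStateSpace (A : Type*) [NormedAddCommGroup A] [NormedSpace ℝ A]
    [FiniteDimensional ℝ A] extends AbstractStateSpace A where
  /-- the physically allowed effects -/
  allowedEffects : Set (Module.Dual ℝ A)
  allowed_subset : allowedEffects ⊆ toAbstractStateSpace.effects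
  allowed_convex : Convex ℝ allowedEffects
  /-- The set of allowed effects is closed. (On the finite-dimensional dual space the topology is
  that of pointwise convergence.) -/
  allowed_closed : IsClosed ((fun e : Module.Dual ℝ A => (e : A → ℝ)) '' allowedEffects)
  /-- The set of allowed effects has full dimension. -/
  allowed_span : Submodule.span ℝ allowedEffects = ⊤
  /-- With an event, also its counter-event is allowed. -/
  allowed_compl : ∀ e ∈ allowedEffects, toAbstractStateSpace.orderUnit - e ∈ allowedEffects
  /-- Two outcomes of a common measurement can be merged. -/
  allowed_add : ∀ e ∈ allowedEffects, ∀ f ∈ allowedEffects,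
    (∀ x ∈ toAbstractStateSpace.cone, e x + f x ≤ toAbstractStateSpace.orderUnit x) →
      e + f ∈ allowedEffects
  /-- the group of physically allowed reversible transformations -/
  reversible : Subgroup (A ≃ₗ[ℝ] A)
  reversible_isTransformation : ∀ T ∈ reversible,
    toAbstractStateSpace.IsTransformation (T : A →ₗ[ℝ] A)
  /-- An allowed effect measured after an allowed transformation is an allowed effect. -/
  allowed_comp : ∀ e ∈ allowedEffects, ∀ T ∈ reversible, e ∘ₗ (T : A →ₗ[ℝ] A) ∈ allowedEffects

namespace DynamicalStateSpace

variable {A : Type*} [NormedAddCommGroup A] [NormedSpace ℝ A] [FiniteDimensional ℝ A]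

/-- States `w 1, …, w n` are perfectly distinguishable if there are allowed effects `e 1, …, e n`
with `∑ j, e j ≤ u` and `e j (w k) = δ_jk`. -/
def PerfectlyDistinguishable (S : DynamicalStateSpace A) {n : ℕ} (w : Fin n → A) : Prop :=
  (∀ k, w k ∈ S.states) ∧
    ∃ e : Fin n → Module.Dual ℝ A, (∀ j, e j ∈ S.allowedEffects) ∧
      (∀ x ∈ S.cone, ∑ j, e j x ≤ S.orderUnit x) ∧
      ∀ j k, e j (w k) = if j = k then 1 else 0

/-- An `n`-frame: `n` perfectly distinguishable pure states. -/
def IsFrame (S : DynamicalStateSpace A) {n : ℕ} (w : Fin n → A) : Prop :=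
  S.PerfectlyDistinguishable w ∧ ∀ k, w k ∈ S.pureStates

/-- A maximal frame: a frame that cannot be enlarged to a bigger frame. -/
def IsMaximalFrame (S : DynamicalStateSpace A) {n : ℕ} (w : Fin n → A) : Prop :=
  S.IsFrame w ∧ ∀ (m : ℕ) (v : Fin m → A), S.IsFrame v →
    Set.range w ⊆ Set.range v → Set.range v ⊆ Set.range w

/-- `x = ∑ j, p j • w j` is a classical decomposition: `p` is a probability distribution and the
`w j` are perfectly distinguishable pure states. -/
structure IsClassicalDecomposition (S : DynamicalStateSpace A) (x : A) {n : ℕ}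
    (p : Fin n → ℝ) (w : Fin n → A) : Prop where
  isFrame : S.IsFrame w
  nonneg : ∀ j, 0 ≤ p j
  sum_eq_one : ∑ j, p j = 1
  eq_sum : x = ∑ j, p j • w j

/-- Postulate 1, classical decomposability: every state has a classical decomposition. -/
def ClassicalDecomposability (S : DynamicalStateSpace A) : Prop :=
  ∀ x ∈ S.states, ∃ (n : ℕ) (p : Fin n → ℝ) (w : Fin n → A), S.IsClassicalDecomposition x p w

/-- Postulate 2, strong symmetry: any two frames of the same size are related by an allowed
reversible transformation. -/
def StrongSymmetry (S : DynamicalStateSpace A) : Prop :=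
  ∀ (n : ℕ) (w v : Fin n → A), S.IsFrame w → S.IsFrame v → ∃ T ∈ S.reversible, ∀ j, T (w j) = v j

/-- The Shannon entropy `-∑ j, p j * ln (p j)`, with `0 * ln 0 = 0`. -/
noncomputable def shannonEntropy {n : ℕ} (p : Fin n → ℝ) : ℝ := ∑ j, Real.negMulLog (p j)

/-- `s` is the well-defined entropy of `x`: the element `x` has a classical decomposition, and the
coefficients of each of its classical decompositions have Shannon entropy `s`. -/
def HasEntropy (S : DynamicalStateSpace A) (x : A) (s : ℝ) : Prop :=
  (∃ (n : ℕ) (p : Fin n → ℝ) (w : Fin n → A), S.IsClassicalDecomposition x p w) ∧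
    ∀ (n : ℕ) (p : Fin n → ℝ) (w : Fin n → A),
      S.IsClassicalDecomposition x p w → shannonEntropy p = s

/-- The entropy of `x`: the `s` with `S.HasEntropy x s` (a junk value if there is none). -/
noncomputable def entropy (S : DynamicalStateSpace A) (x : A) : ℝ :=
  Classical.epsilon (S.HasEntropy x)

/-- A non-degenerate projective measurement: positive projectors `P j` that form an operation, where
`P j` projects onto the line spanned by `f j`, and the pure states `f j` form a maximal frame.
(The projectors are not required to be symmetric, so symmetric ones are a special case.) -/
structure IsNondegenerateProjectiveMeasurement (S : DynamicalStateSpace A) {n : ℕ}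
    (P : Fin n → (A →ₗ[ℝ] A)) (f : Fin n → A) : Prop where
  isMaximalFrame : S.IsMaximalFrame f
  isOperation : S.IsOperation P
  idempotent : ∀ j, P j ∘ₗ P j = P j
  range_eq : ∀ j, LinearMap.range (P j) = Submodule.span ℝ {f j}

/-- The state of an ensemble, initially in the state `x`, after the operation `P` has been performed
on all its systems: the mixture of the states `P j x / u (P j x)` with weights `u (P j x)`, that is,
the sum of the `P j x`. -/
def stateAfter {n : ℕ} (P : Fin n → (A →ₗ[ℝ] A)) (x : A) : A := ∑ j, P j x

end DynamicalStateSpace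

/-! Expand `w` over a maximal frame `v` with weights `q`. The measurement yields the weights `M q`
on the frame `f`, with `M j k = u (P j (v k))`, so `w'` comes classically decomposed. If `M` is
doubly stochastic, Jensen's inequality for `-t ln t` gives the entropy increase. Columns of `M` sum
to one by normalization. For rows, `∑ k, v k` must not depend on the maximal frame
(`IsMaximalFrame.sum_eq_sum`). A centroid argument gives a state fixed by all reversible maps.
Strong symmetry permutes any frame, so this state has equal weights on a maximal frame, whose sum is
thus a multiple of it; symmetry carries this over to every maximal frame. Entropy is well defined
because the effects of a frame read off its weights: the same inequality applies both ways between
two decompositions. -/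

open MeasureTheory

/-! ### Centroids of convex bodies -/

section Centroid

variable {E : Type*} [NormedAddCommGroup E] [NormedSpace ℝ E] [FiniteDimensional ℝ E]

/-- A convex body contains a point (its centroid) that is fixed, up to the Jacobian, by all
linear automorphisms of the body. -/
theorem Convex.exists_mem_forall_eq_smul_of_image_eq {K : Set E} (hK : Convex ℝ K)
    (hKc : IsCompact K) (hKi : (interior K).Nonempty) :
    ∃ c ∈ K, ∀ T : E ≃ₗ[ℝ] E, T '' K = K → ∃ r : ℝ, c = r • T c := by
  borelize E
  let μ : Measure E := Measure.addHaar
  have h0 : μ K ≠ 0 := fun h => by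
    have := measure_mono_null interior_subset h
    exact (isOpen_interior.measure_pos μ hKi).ne' this
  refine ⟨⨍ x in K, x ∂μ, hK.set_average_mem hKc.isClosed h0 hKc.measure_lt_top.ne
    (ae_restrict_mem hKc.measurableSet) (continuousOn_id.integrableOn_compact hKc), ?_⟩
  intro T hT
  let L : E ≃L[ℝ] E := T.toContinuousLinearEquiv
  refine ⟨|(L : E →L[ℝ] E).det|, ?_⟩
  -- Change of variables with constant Jacobian: integrating `x` over `T '' K = K` gives `|det T|`
  -- times `T` of the integral over `K`.
  have key := integral_image_eq_integral_abs_det_fderiv_smul μ hKc.measurableSet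
    (f := L) (f' := fun _ => (L : E →L[ℝ] E)) (fun x _ => L.hasFDerivAt.hasFDerivWithinAt)
    L.injective.injOn (fun x => x)
  have hL : L '' K = K := hT
  rw [hL, integral_smul, L.integral_comp_comm] at key
  rw [setAverage_eq]
  have hTL : ∀ x, T x = L x := fun _ => rfl
  rw [hTL, map_smul, smul_comm, ← key]

end Centroid

/-! ### Doubly stochastic averaging and padding by zeros -/

theorem ConcaveOn.sum_le_sum_of_doublyStochastic {ι κ : Type*} [Fintype ι] [Fintype κ]
    {s : Set ℝ} {φ : ℝ → ℝ} (hφ : ConcaveOn ℝ s φ) {M : ι → κ → ℝ} {q : κ → ℝ}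
    (hM : ∀ i k, 0 ≤ M i k) (hrow : ∀ i, ∑ k, M i k = 1) (hcol : ∀ k, ∑ i, M i k = 1)
    (hq : ∀ k, q k ∈ s) : ∑ k, φ (q k) ≤ ∑ i, φ (∑ k, M i k * q k) := by
  calc ∑ k, φ (q k) = ∑ i, ∑ k, M i k * φ (q k) := by
        rw [Finset.sum_comm]
        exact Finset.sum_congr rfl fun k _ => by rw [← Finset.sum_mul, hcol, one_mul]
    _ ≤ _ := Finset.sum_le_sum fun i _ => by
        simpa only [smul_eq_mul] using
          hφ.le_map_sum (fun k _ => hM i k) (hrow i) (fun k _ => hq k)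

/-- Used when a frame is enlarged: the added states get weight zero, and contribute nothing to total
weight, mixture or entropy. -/
theorem sum_apply_extend_zero {ι κ R B : Type*} [Fintype ι] [Fintype κ] [Zero R]
    [AddCommMonoid B] {σ : ι → κ} (hσ : Function.Injective σ) (p : ι → R) (F : κ → R → B)
    (hF : ∀ j, F j 0 = 0) : ∑ j, F j (Function.extend σ p 0 j) = ∑ i, F (σ i) (p i) := by
  refine (Finset.sum_of_injOn σ hσ.injOn (fun _ _ => Finset.mem_coe.2 (Finset.mem_univ _))
    (fun j _ hj => ?_) fun i _ => by rw [hσ.extend_apply]).symm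
  rw [Function.extend_apply' _ _ _ (by simpa using hj), Pi.zero_apply, hF]

/-! ### The cone and a full-dimensional slab of it -/

namespace AbstractStateSpace

variable {A : Type*} [NormedAddCommGroup A] [NormedSpace ℝ A] [FiniteDimensional ℝ A]
  (S : AbstractStateSpace A)

theorem states_subset_cone : S.states ⊆ S.cone :=
  fun x hx => ⟨1, zero_le_one, x, hx, (one_smul ℝ x).symm⟩

theorem smul_mem_cone {r : ℝ} (hr : 0 ≤ r) {x : A} (hx : x ∈ S.cone) : r • x ∈ S.cone :=
  S.isPointedCone.smul_mem r hr x hx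

theorem sum_mem_cone {ι : Type*} (s : Finset ι) {x : ι → A} (hx : ∀ i ∈ s, x i ∈ S.cone) :
    ∑ i ∈ s, x i ∈ S.cone := by
  classical
  induction s using Finset.induction_on with
  | empty =>
    obtain ⟨y, hy⟩ := S.isPointedCone.nonempty
    simpa using S.smul_mem_cone le_rfl hy
  | insert i s hi ih =>
    rw [Finset.sum_insert hi]
    exact S.isPointedCone.add_mem _ (hx i (Finset.mem_insert_self i s)) _
      (ih fun j hj => hx j (Finset.mem_insert_of_mem hj))

theorem orderUnit_eq_one {x : A} (hx : x ∈ S.states) : S.orderUnit x = 1 :=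
  (S.orderUnit_eq_one_iff x (S.states_subset_cone hx)).2 hx

theorem mem_states {x : A} (hx : x ∈ S.cone) (h : S.orderUnit x = 1) : x ∈ S.states :=
  (S.orderUnit_eq_one_iff x hx).1 h

theorem states_nonempty : S.states.Nonempty := by
  obtain ⟨_, _, _, w, hw, _⟩ := S.isPointedCone.nonempty
  exact ⟨w, hw⟩

/-- The part of the cone with normalization between `1` and `2`, a convex body. -/
def slab : Set A := {x | x ∈ S.cone ∧ 1 ≤ S.orderUnit x ∧ S.orderUnit x ≤ 2}

theorem convex_slab : Convex ℝ S.slab := by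
  intro x hx y hy a b ha hb hab
  refine ⟨S.isPointedCone.add_mem _ (S.smul_mem_cone ha hx.1) _ (S.smul_mem_cone hb hy.1), ?_, ?_⟩
  · rw [map_add, map_smul, map_smul, smul_eq_mul, smul_eq_mul]
    nlinarith [hx.2.1, hy.2.1]
  · rw [map_add, map_smul, map_smul, smul_eq_mul, smul_eq_mul]
    nlinarith [hx.2.2, hy.2.2]

theorem slab_eq_image :
    S.slab = (fun p : ℝ × A => p.1 • p.2) '' (Set.Icc (1 : ℝ) 2 ×ˢ S.states) := by
  ext x
  constructor
  · rintro ⟨⟨r, -, w, hw, rfl⟩, h1, h2⟩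
    rw [map_smul, S.orderUnit_eq_one hw, smul_eq_mul, mul_one] at h1 h2
    exact ⟨(r, w), ⟨⟨h1, h2⟩, hw⟩, rfl⟩
  · rintro ⟨⟨r, w⟩, ⟨⟨h1, h2⟩, hw⟩, rfl⟩
    have hu : S.orderUnit (r • w) = r := by
      rw [map_smul, S.orderUnit_eq_one hw, smul_eq_mul, mul_one]
    exact ⟨⟨r, zero_le_one.trans h1, w, hw, rfl⟩, hu.symm ▸ h1, hu.symm ▸ h2⟩

theorem isCompact_slab : IsCompact S.slab := by
  rw [slab_eq_image]
  exact (isCompact_Icc.prod S.isCompact_states).image (by fun_prop)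

/-- The slab contains `w` and `2 • w` for each state `w`, so its affine span contains the line `ℝ
w`; these lines span `A`. -/
theorem interior_slab_nonempty : (interior S.slab).Nonempty := by
  rw [S.convex_slab.interior_nonempty_iff_affineSpan_eq_top]
  have mem : ∀ w ∈ S.states, ∀ r : ℝ, r • w ∈ affineSpan ℝ S.slab := by
    intro w hw r
    have h : ∀ r ∈ Set.Icc (1 : ℝ) 2, r • w ∈ affineSpan ℝ S.slab := fun r hr =>
      subset_affineSpan ℝ _ (S.slab_eq_image ▸ ⟨(r, w), ⟨hr, hw⟩, rfl⟩)
    have := AffineMap.lineMap_mem (r - 1) (h 1 (by norm_num)) (h 2 (by norm_num))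
    rw [AffineMap.lineMap_apply_module'] at this
    convert this using 1
    module
  obtain ⟨w, hw⟩ := S.states_nonempty
  have h0 : (0 : A) ∈ affineSpan ℝ S.slab := by simpa using mem w hw 0
  rw [← AffineSubspace.direction_eq_top_iff_of_nonempty ⟨0, h0⟩, eq_top_iff, ← S.generating,
    Submodule.span_le]
  rintro _ ⟨r, -, v, hv, rfl⟩
  simpa using AffineSubspace.vsub_mem_direction (mem v hv r) h0

end AbstractStateSpace

/-! ### Reversible transformations and the invariant state -/

namespace DynamicalStateSpace

variable {A : Type*} [NormedAddCommGroup A] [NormedSpace ℝ A] [FiniteDimensional ℝ A]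
  {S : DynamicalStateSpace A}

theorem map_mem_cone {T : A ≃ₗ[ℝ] A} (hT : T ∈ S.reversible) {x : A} (hx : x ∈ S.cone) :
    T x ∈ S.cone :=
  (S.reversible_isTransformation T hT).positive x hx

/-- Neither `T` nor its inverse increases the normalization. -/
theorem orderUnit_map {T : A ≃ₗ[ℝ] A} (hT : T ∈ S.reversible) {x : A} (hx : x ∈ S.cone) :
    S.orderUnit (T x) = S.orderUnit x := by
  refine le_antisymm ((S.reversible_isTransformation T hT).orderUnit_le x hx) ?_
  have := (S.reversible_isTransformation _ (S.reversible.inv_mem hT)).orderUnit_le _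
    (map_mem_cone hT hx)
  simpa using this

theorem image_eq_of_map_mem {K : Set A}
    (hK : ∀ T ∈ S.reversible, ∀ x ∈ K, T x ∈ K) {T : A ≃ₗ[ℝ] A} (hT : T ∈ S.reversible) :
    T '' K = K := by
  refine Set.Subset.antisymm (Set.image_subset_iff.2 fun x hx => hK T hT x hx) fun x hx => ?_
  exact ⟨T⁻¹ x, hK _ (S.reversible.inv_mem hT) x hx, T.apply_symm_apply x⟩

theorem map_mem_states {T : A ≃ₗ[ℝ] A} (hT : T ∈ S.reversible) {x : A} (hx : x ∈ S.states) :
    T x ∈ S.states :=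
  S.mem_states (map_mem_cone hT (S.states_subset_cone hx))
    ((orderUnit_map hT (S.states_subset_cone hx)).trans (S.orderUnit_eq_one hx))

theorem map_mem_pureStates {T : A ≃ₗ[ℝ] A} (hT : T ∈ S.reversible) {x : A}
    (hx : x ∈ S.pureStates) : T x ∈ S.pureStates := by
  have := image_extremePoints (𝕜 := ℝ) T S.states
  rw [image_eq_of_map_mem (fun T hT x hx => map_mem_states hT hx) hT] at this
  exact this.subset (Set.mem_image_of_mem T hx)

/-- There is a state that is invariant under all reversible transformations. -/
theorem exists_invariant_state (S : DynamicalStateSpace A) :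
    ∃ μ ∈ S.states, ∀ T ∈ S.reversible, T μ = μ := by
  -- The states lie in the hyperplane `u = 1` and have no interior, hence the slab. Comparing `u` on
  -- both sides forces the Jacobian factor to be `1`.
  obtain ⟨c, hc, h⟩ := S.convex_slab.exists_mem_forall_eq_smul_of_image_eq S.isCompact_slab
    S.interior_slab_nonempty
  have hu : 0 < S.orderUnit c := zero_lt_one.trans_le hc.2.1
  refine ⟨(S.orderUnit c)⁻¹ • c, S.mem_states (S.smul_mem_cone (inv_nonneg.2 hu.le) hc.1) ?_,
    fun T hT => ?_⟩
  · rw [map_smul, smul_eq_mul, inv_mul_cancel₀ hu.ne']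
  obtain ⟨r, hr⟩ := h T (image_eq_of_map_mem (K := S.slab)
    (fun T hT x hx => ⟨map_mem_cone hT hx.1, by rw [orderUnit_map hT hx.1]; exact hx.2⟩) hT)
  have h1 := congrArg S.orderUnit hr
  rw [map_smul, orderUnit_map hT hc.1, smul_eq_mul] at h1
  have hr1 : r = 1 := by
    have : (r - 1) * S.orderUnit c = 0 := by linarith
    rcases mul_eq_zero.1 this with h | h <;> linarith
  rw [hr1, one_smul] at hr
  rw [map_smul, ← hr]

/-! ### Frames and maximal frames -/

theorem IsFrame.map {n : ℕ} {w : Fin n → A} (hw : S.IsFrame w) {T : A ≃ₗ[ℝ] A}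
    (hT : T ∈ S.reversible) : S.IsFrame (fun k => T (w k)) := by
  obtain ⟨⟨hs, e, he, hle, hd⟩, hp⟩ := hw
  have hT' := S.reversible.inv_mem hT
  refine ⟨⟨fun k => map_mem_states hT (hs k), fun j => e j ∘ₗ (T⁻¹ : A ≃ₗ[ℝ] A).toLinearMap,
    fun j => S.allowed_comp _ (he j) _ hT', fun x hx => ?_, fun j k => ?_⟩,
    fun k => map_mem_pureStates hT (hp k)⟩
  · exact (hle _ (map_mem_cone hT' hx)).trans_eq (orderUnit_map hT' hx)
  · rw [← hd j k]
    exact congrArg (e j) (T.symm_apply_apply (w k))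

/-- A subfamily of a frame is a frame. -/
theorem IsFrame.comp {m n : ℕ} {w : Fin n → A} (hw : S.IsFrame w) {σ : Fin m → Fin n}
    (hσ : Function.Injective σ) : S.IsFrame (w ∘ σ) := by
  obtain ⟨⟨hs, e, he, hle, hd⟩, hp⟩ := hw
  refine ⟨⟨fun k => hs _, fun j => e (σ j), fun j => he _, fun x hx => ?_, fun j k => ?_⟩,
    fun k => hp _⟩
  · refine le_trans ?_ (hle x hx)
    rw [← Finset.sum_image (f := fun j => e j x) (g := σ) (s := Finset.univ) hσ.injOn]
    exact Finset.sum_le_sum_of_subset_of_nonneg (Finset.subset_univ _)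
      fun j _ _ => (S.allowed_subset (he j) x hx).1
  · simp [hd, hσ.eq_iff]

theorem IsFrame.linearIndependent {n : ℕ} {w : Fin n → A} (hw : S.IsFrame w) :
    LinearIndependent ℝ w := by
  obtain ⟨⟨-, e, -, -, hd⟩, -⟩ := hw
  refine Fintype.linearIndependent_iff.2 fun g hg i => ?_
  simpa [hd] using congrArg (e i) hg

theorem IsFrame.injective {n : ℕ} {w : Fin n → A} (hw : S.IsFrame w) : Function.Injective w :=
  hw.linearIndependent.injective

/-- Frames are linearly independent, so the dimension bounds their size; a largest frame containing
`w` is maximal. -/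
theorem IsFrame.exists_isMaximalFrame {n : ℕ} {w : Fin n → A} (hw : S.IsFrame w) :
    ∃ (m : ℕ) (v : Fin m → A) (σ : Fin n → Fin m),
      S.IsMaximalFrame v ∧ Function.Injective σ ∧ v ∘ σ = w := by
  classical
  let Q : ℕ → Prop := fun m => ∃ v : Fin m → A, S.IsFrame v ∧ Set.range w ⊆ Set.range v
  have hb : ∀ m, Q m → m ≤ Module.finrank ℝ A := fun m ⟨v, hv, _⟩ => by
    simpa using hv.linearIndependent.fintype_card_le_finrank
  have hQn : Q n := ⟨w, hw, subset_rfl⟩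
  obtain ⟨v, hv, hwv⟩ : Q (Nat.findGreatest Q (Module.finrank ℝ A)) :=
    Nat.findGreatest_spec (hb n hQn) hQn
  choose σ hσ using fun j => hwv (Set.mem_range_self j)
  refine ⟨_, v, σ, ⟨hv, fun m v' hv' hvv' => ?_⟩, fun i j hij => hw.injective ?_, funext hσ⟩
  · have hQ : Q m := ⟨v', hv', hwv.trans hvv'⟩
    have hle := Nat.le_findGreatest (hb m hQ) hQ
    refine (Set.eq_of_subset_of_ncard_le hvv' ?_ (Set.finite_range v')).ge
    rw [← Set.image_univ, ← Set.image_univ, Set.ncard_image_of_injective _ hv'.injective,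
      Set.ncard_image_of_injective _ hv.injective]
    simpa [Set.ncard_univ] using hle
  · rw [← hσ i, ← hσ j, hij]

/-- Were `v` longer, strong symmetry would carry its first `n` states to `w`, and the image of `v`
would properly enlarge `w`. -/
theorem IsMaximalFrame.card_le (hP2 : S.StrongSymmetry) {n m : ℕ} {w : Fin n → A} {v : Fin m → A}
    (hw : S.IsMaximalFrame w) (hv : S.IsFrame v) : m ≤ n := by
  by_contra! hlt
  obtain ⟨T, hT, h⟩ := hP2 n _ w (hv.comp (Fin.castLE_injective hlt.le)) hw.1
  have hTv := hv.map hT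
  have hsub := hw.2 m _ hTv (by rintro _ ⟨j, rfl⟩; exact ⟨_, h j⟩)
  obtain ⟨j, hj⟩ := hsub ⟨⟨n, hlt⟩, rfl⟩
  rw [← h j] at hj
  have := congrArg Fin.val (hTv.injective hj)
  exact j.2.ne this

theorem IsMaximalFrame.card_eq (hP2 : S.StrongSymmetry) {n m : ℕ} {w : Fin n → A} {v : Fin m → A}
    (hw : S.IsMaximalFrame w) (hv : S.IsMaximalFrame v) : m = n :=
  (hw.card_le hP2 hv.1).antisymm (hv.card_le hP2 hw.1)

theorem IsClassicalDecomposition.exists_isMaximalFrame {x : A} {n : ℕ} {p : Fin n → ℝ}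
    {w : Fin n → A} (h : S.IsClassicalDecomposition x p w) :
    ∃ (m : ℕ) (q : Fin m → ℝ) (v : Fin m → A), S.IsMaximalFrame v ∧
      S.IsClassicalDecomposition x q v ∧ shannonEntropy q = shannonEntropy p := by
  obtain ⟨m, v, σ, hv, hσ, rfl⟩ := h.isFrame.exists_isMaximalFrame
  refine ⟨m, Function.extend σ p 0, v, hv, ⟨hv.1, fun j => ?_, ?_, ?_⟩, ?_⟩
  · by_cases hj : ∃ i, σ i = j
    · obtain ⟨i, rfl⟩ := hj
      rw [hσ.extend_apply]
      exact h.nonneg i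
    · rw [Function.extend_apply' _ _ _ hj, Pi.zero_apply]
  · exact (sum_apply_extend_zero hσ p (fun _ r => r) fun _ => rfl).trans h.sum_eq_one
  · exact h.eq_sum.trans (sum_apply_extend_zero hσ p (fun j r => r • v j) fun _ => zero_smul _ _).symm
  · exact sum_apply_extend_zero hσ p (fun _ => Real.negMulLog) fun _ => Real.negMulLog_zero

/-! ### Double stochasticity and entropy -/

/-- The states of a maximal frame add up to a multiple of the maximally mixed state; in particular
the sum is the same for all maximal frames. -/
theorem IsMaximalFrame.sum_eq_sum (hP1 : S.ClassicalDecomposability) (hP2 : S.StrongSymmetry)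
    {n m : ℕ} {w : Fin n → A} {v : Fin m → A} (hw : S.IsMaximalFrame w)
    (hv : S.IsMaximalFrame v) : ∑ k, v k = ∑ k, w k := by
  obtain ⟨μ, hμ, hinv⟩ := S.exists_invariant_state
  obtain ⟨_, _, _, h⟩ := hP1 μ hμ
  obtain ⟨N, p, f, hf, hd, -⟩ := h.exists_isMaximalFrame
  obtain ⟨e, -, -, he⟩ := hf.1.1.2
  have hval : ∀ i, e i μ = p i := fun i => by simp [hd.eq_sum, he]
  have hp : ∀ i j, p i = p j := by
    intro i j
    -- A reversible `T` swaps `f i` and `f j` but fixes `μ`, so the weights `p i` and `p j`, read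
    -- off by `e i`, agree.
    obtain ⟨T, hT, h⟩ := hP2 N f _ hf.1 (hf.1.comp (Equiv.swap i j).injective)
    have hTμ : μ = ∑ k, p k • f (Equiv.swap i j k) := by
      conv_lhs => rw [← hinv T hT, hd.eq_sum]
      simp [h]
    have := hval i
    rw [hTμ, ← Equiv.sum_comp (Equiv.swap i j)] at this
    simpa [he] using this.symm
  have hsum : ∀ {l : ℕ} {g : Fin l → A}, S.IsMaximalFrame g → ∑ k, g k = (N : ℝ) • μ := by
    intro l g hg
    obtain rfl := hf.card_eq hP2 hg
    obtain ⟨T, hT, h⟩ := hP2 _ f g hf.1 hg.1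
    have hpl : ∀ i, (l : ℝ) * p i = 1 := fun i => by
      rw [← hd.sum_eq_one, Finset.sum_congr rfl fun j _ => hp j i]
      simp
    calc ∑ k, g k = T (∑ k, f k) := by simp [h]
      _ = T ((l : ℝ) • μ) := by
        rw [hd.eq_sum, Finset.smul_sum]
        exact congrArg T (Finset.sum_congr rfl fun k _ => by rw [smul_smul, hpl, one_smul])
      _ = (l : ℝ) • μ := by rw [map_smul, hinv T hT]
  rw [hsum hv, hsum hw]

/-- The matrix `E j (v k)` is doubly stochastic, for positive functionals `E j` with `∑ j, E j ≤ u`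
that perfectly distinguish the states of a maximal frame `f`, and any maximal frame `v`. -/
theorem IsMaximalFrame.doublyStochastic (hP1 : S.ClassicalDecomposability)
    (hP2 : S.StrongSymmetry) {n m : ℕ} {f : Fin n → A} (hf : S.IsMaximalFrame f) {v : Fin m → A}
    (hv : S.IsMaximalFrame v) {E : Fin n → Module.Dual ℝ A}
    (hle : ∀ x ∈ S.cone, ∑ j, E j x ≤ S.orderUnit x)
    (hd : ∀ j k, E j (f k) = if j = k then 1 else 0) :
    (∀ k, ∑ j, E j (v k) = 1) ∧ ∀ j, ∑ k, E j (v k) = 1 := by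
  have hrow : ∀ j, ∑ k, E j (v k) = 1 := fun j => by
    rw [← map_sum, hf.sum_eq_sum hP1 hP2 hv, map_sum]
    simp [hd]
  have hcol : ∀ k ∈ Finset.univ, ∑ j, E j (v k) ≤ 1 := fun k _ =>
    (hle _ (S.states_subset_cone (hv.1.1.1 k))).trans_eq (S.orderUnit_eq_one (hv.1.1.1 k))
  -- The rows give total `n = m`, so `m` column sums, each at most `1`, must all equal `1`.
  refine ⟨fun k => (Finset.sum_eq_sum_iff_of_le hcol).1 ?_ k (Finset.mem_univ k), hrow⟩
  rw [Finset.sum_comm, Finset.sum_congr rfl fun j _ => hrow j]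
  simp [hf.card_eq hP2 hv]

/-- A measurement that perfectly distinguishes the states of a maximal frame has an outcome
distribution at least as mixed as any classical decomposition. -/
theorem IsClassicalDecomposition.shannonEntropy_le (hP1 : S.ClassicalDecomposability)
    (hP2 : S.StrongSymmetry) {n m : ℕ} {f : Fin n → A} (hf : S.IsMaximalFrame f)
    {x : A} {q : Fin m → ℝ} {v : Fin m → A} (h : S.IsClassicalDecomposition x q v)
    {E : Fin n → Module.Dual ℝ A} (hE : ∀ j, ∀ x ∈ S.cone, 0 ≤ E j x)
    (hle : ∀ x ∈ S.cone, ∑ j, E j x ≤ S.orderUnit x)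
    (hd : ∀ j k, E j (f k) = if j = k then 1 else 0) :
    shannonEntropy q ≤ shannonEntropy fun j => E j x := by
  obtain ⟨l, p, g, hg, hp, hpq⟩ := h.exists_isMaximalFrame
  obtain ⟨hcol, hrow⟩ := hf.doublyStochastic hP1 hP2 hg hle hd
  have hx : ∀ j, E j x = ∑ k, E j (g k) * p k := fun j => by
    rw [hp.eq_sum, map_sum]
    exact Finset.sum_congr rfl fun k _ => by rw [map_smul, smul_eq_mul, mul_comm]
  rw [← hpq]
  simp only [shannonEntropy, hx]
  exact Real.concaveOn_negMulLog.sum_le_sum_of_doublyStochastic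
    (fun j k => hE j _ (S.states_subset_cone (hg.1.1.1 k))) hrow hcol hp.nonneg

theorem IsClassicalDecomposition.shannonEntropy_le_of_isClassicalDecomposition
    (hP1 : S.ClassicalDecomposability) (hP2 : S.StrongSymmetry) {n m : ℕ} {x : A}
    {p : Fin n → ℝ} {w : Fin n → A} {q : Fin m → ℝ} {v : Fin m → A}
    (hq : S.IsClassicalDecomposition x q v) (hp : S.IsClassicalDecomposition x p w) :
    shannonEntropy q ≤ shannonEntropy p := by
  obtain ⟨l, r, g, hg, hr, hrp⟩ := hp.exists_isMaximalFrame
  obtain ⟨e, hea, hle, hd⟩ := hg.1.1.2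
  have hval : r = fun j => e j x := funext fun j => by simp [hr.eq_sum, hd]
  rw [← hrp, hval]
  exact hq.shannonEntropy_le hP1 hP2 hg (fun j x hx => (S.allowed_subset (hea j) x hx).1) hle hd

theorem IsClassicalDecomposition.hasEntropy (hP1 : S.ClassicalDecomposability)
    (hP2 : S.StrongSymmetry) {n : ℕ} {x : A} {p : Fin n → ℝ} {w : Fin n → A}
    (h : S.IsClassicalDecomposition x p w) : S.HasEntropy x (shannonEntropy p) :=
  ⟨⟨n, p, w, h⟩, fun _ _ _ h' =>
    (h'.shannonEntropy_le_of_isClassicalDecomposition hP1 hP2 h).antisymm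
      (h.shannonEntropy_le_of_isClassicalDecomposition hP1 hP2 h')⟩

theorem HasEntropy.hasEntropy_entropy {x : A} {s : ℝ} (h : S.HasEntropy x s) :
    S.HasEntropy x (S.entropy x) :=
  Classical.epsilon_spec (p := S.HasEntropy x) ⟨s, h⟩

theorem IsClassicalDecomposition.entropy_eq (hP1 : S.ClassicalDecomposability)
    (hP2 : S.StrongSymmetry) {n : ℕ} {x : A} {p : Fin n → ℝ} {w : Fin n → A}
    (h : S.IsClassicalDecomposition x p w) : S.entropy x = shannonEntropy p :=
  ((h.hasEntropy hP1 hP2).hasEntropy_entropy.2 _ _ _ h).symm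

/-! ### The projective measurement -/

namespace IsNondegenerateProjectiveMeasurement

variable {n : ℕ} {P : Fin n → (A →ₗ[ℝ] A)} {f : Fin n → A}
  (hP : S.IsNondegenerateProjectiveMeasurement P f)
include hP

theorem apply_eq_smul (j : Fin n) (x : A) : P j x = S.orderUnit (P j x) • f j := by
  have : P j x ∈ Submodule.span ℝ {f j} := hP.range_eq j ▸ LinearMap.mem_range_self _ x
  obtain ⟨c, hc⟩ := Submodule.mem_span_singleton.1 this
  rw [← hc, map_smul, S.orderUnit_eq_one (hP.isMaximalFrame.1.1.1 j), smul_eq_mul, mul_one]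

theorem orderUnit_apply_nonneg (j : Fin n) {x : A} (hx : x ∈ S.cone) :
    0 ≤ S.orderUnit (P j x) := by
  by_cases h : P j x = 0
  · rw [h, map_zero]
  · exact (S.orderUnit_pos _ ((hP.isOperation.isTransformation j).positive x hx) h).le

theorem sum_orderUnit_apply (x : A) : ∑ j, S.orderUnit (P j x) = S.orderUnit x := by
  simpa using LinearMap.congr_fun hP.isOperation.sum_eq x

/-- The projector `P k` fixes `f k`, so outcome `k` exhausts the normalization and the other,
non-negative, terms vanish. -/
theorem orderUnit_apply_frame (j k : Fin n) :
    S.orderUnit (P j (f k)) = if j = k then 1 else 0 := by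
  have hf := hP.isMaximalFrame.1.1.1
  have hdiag : ∀ k, S.orderUnit (P k (f k)) = 1 := fun k => by
    have hk : f k ∈ LinearMap.range (P k) := by
      rw [hP.range_eq k]
      exact Submodule.mem_span_singleton_self _
    obtain ⟨y, hy⟩ := hk
    have := LinearMap.congr_fun (hP.idempotent k) y
    rw [LinearMap.comp_apply, hy] at this
    rw [this, S.orderUnit_eq_one (hf k)]
  split_ifs with h
  · rw [h, hdiag]
  · have hsum := hP.sum_orderUnit_apply (f k)
    rw [S.orderUnit_eq_one (hf k), ← Finset.add_sum_erase _ _ (Finset.mem_univ k), hdiag,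
      add_eq_left, Finset.sum_eq_zero_iff_of_nonneg
        fun i _ => hP.orderUnit_apply_nonneg i (S.states_subset_cone (hf k))] at hsum
    exact hsum j (Finset.mem_erase.2 ⟨h, Finset.mem_univ j⟩)

theorem stateAfter_mem_states {x : A} (hx : x ∈ S.states) : stateAfter P x ∈ S.states := by
  refine S.mem_states (S.sum_mem_cone _ fun j _ =>
    (hP.isOperation.isTransformation j).positive x (S.states_subset_cone hx)) ?_
  rw [stateAfter, map_sum, hP.sum_orderUnit_apply, S.orderUnit_eq_one hx]

theorem isClassicalDecomposition_stateAfter {x : A} (hx : x ∈ S.states) :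
    S.IsClassicalDecomposition (stateAfter P x) (fun j => S.orderUnit (P j x)) f where
  isFrame := hP.isMaximalFrame.1
  nonneg j := hP.orderUnit_apply_nonneg j (S.states_subset_cone hx)
  sum_eq_one := (hP.sum_orderUnit_apply x).trans (S.orderUnit_eq_one hx)
  eq_sum := Finset.sum_congr rfl fun j _ => hP.apply_eq_smul j x

end IsNondegenerateProjectiveMeasurement

end DynamicalStateSpace

theorem mainTheorem5 {A : Type*} [NormedAddCommGroup A] [NormedSpace ℝ A] [FiniteDimensional ℝ A]
    (S : DynamicalStateSpace A) (hP1 : S.ClassicalDecomposability) (hP2 : S.StrongSymmetry)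
    {n : ℕ} (P : Fin n → (A →ₗ[ℝ] A)) (f : Fin n → A)
    (hP : S.IsNondegenerateProjectiveMeasurement P f)
    (w : A) (hw : w ∈ S.states) :
    -- the transition matrix from any maximal frame is square and doubly stochastic
    (∀ (m : ℕ) (v : Fin m → A), S.IsMaximalFrame v →
      m = n ∧
      (∀ j k, 0 ≤ S.orderUnit (P j (v k))) ∧
      (∀ k, ∑ j, S.orderUnit (P j (v k)) = 1) ∧
      (∀ j, ∑ k, S.orderUnit (P j (v k)) = 1)) ∧
    -- the ensemble is in a state after the measurement, and both entropies are well-defined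
    DynamicalStateSpace.stateAfter P w ∈ S.states ∧
    S.HasEntropy w (S.entropy w) ∧
    S.HasEntropy (DynamicalStateSpace.stateAfter P w)
      (S.entropy (DynamicalStateSpace.stateAfter P w)) ∧
    -- the second law
    S.entropy w ≤ S.entropy (DynamicalStateSpace.stateAfter P w) := by
  have hle : ∀ x ∈ S.cone, ∑ j, (S.orderUnit ∘ₗ P j) x ≤ S.orderUnit x :=
    fun x _ => (hP.sum_orderUnit_apply x).le
  have hafter := hP.isClassicalDecomposition_stateAfter hw
  obtain ⟨_, _, _, h⟩ := hP1 w hw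
  refine ⟨fun m v hv => ⟨hP.isMaximalFrame.card_eq hP2 hv, fun j k =>
    hP.orderUnit_apply_nonneg j (S.states_subset_cone (hv.1.1.1 k)),
    hP.isMaximalFrame.doublyStochastic hP1 hP2 hv hle hP.orderUnit_apply_frame⟩,
    hP.stateAfter_mem_states hw, (h.hasEntropy hP1 hP2).hasEntropy_entropy,
    (hafter.hasEntropy hP1 hP2).hasEntropy_entropy, ?_⟩
  rw [h.entropy_eq hP1 hP2, hafter.entropy_eq hP1 hP2]
  -- The functionals `u ∘ P j` are not assumed to be allowed effects; positivity and `∑ j, u ∘ P j ≤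
  -- u` suffice.
  exact h.shannonEntropy_le hP1 hP2 hP.isMaximalFrame
    (fun j x hx => hP.orderUnit_apply_nonneg j hx) hle hP.orderUnit_apply_frame
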